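/- For $s\in\mathbb C$ and real $z>0$ let $\zeta(s,z)$ be the Hurwitz zeta function, i.e. the analytic continuation to $s\neq 1$ of $\sum_{j=0}^{\infty}(j+z)^{-s}$ ($\Re s>1$), let $\zeta'(s,z)=\frac{\partial}{\partial s}\zeta(s,z)$, and let $\gamma$ be Euler's constant. For integers $0\le k\le m$ and $x\in\mathbb C$ let the signed generalized Stirling polynomials $P_k(m,x)$ be defined by the identity in $j$ $$(j+1)(j+2)\cdots(j+m)=\sum_{k=0}^{m}(-1)^kP_k(m,x)\,(j+x)^{m-k}.$$ **Theorem (Generalization of $\Delta_n$).** Let $n\geq 1$ be an integer, $a>0$ and $\Re b>0$. Then the integral $\Delta_n(a,b):=\int_0^\infty \ln(ax)\,\operatorname{sech}^n(bx)\,dx$ converges absolutely and $$\Delta_n(a,b)=\frac{2^{n-2}\,\Gamma^2\!\left(\frac n2\right)\ln\!\left(\frac ab\right)}{b\,(n-1)!}+\frac{2^{2n-1}}{b\,(n-1)!}\sum_{k=2}^{n+1}\left(-\frac12\right)^{k}P_{k-2}\!\left(n-1,\frac n2\right)\Big[\zeta'\!\left(k-n,\tfrac n4\right)-\zeta'\!\left(k-n,\tfrac{n+2}4\right)-(\gamma+\ln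 4)\left(\zeta\!\left(k-n,\tfrac n4\right)-\zeta\!\left(k-n,\tfrac{n+2}4\right)\right)\Big],$$ where $\ln(a/b)$ is the principal logarithm. In the last summand ($k-n=1$), the differences $\zeta(s,\frac n4)-\zeta(s,\frac{n+2}4)$ and $\zeta'(s,\frac n4)-\zeta'(s,\frac{n+2}4)$ have removable singularities at $s=1$ and are understood as their limits as $s\to1$. -/

import Mathlib

open scoped Topology

/-- The complex hyperbolic secant. -/
noncomputable def csech (z : ℂ) : ℂ := 1 / Complex.cosh z

/-- The signed generalized Stirling polynomial `P_k(m, x)`, defined by the expansion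
`(j + 1)_m = ∑_{k=0}^m (-1)^k P_k(m, x) (j + x)^(m - k)` (identically in `j`), where `(·)_m` is the
rising factorial: in terms of `T = j + x` it is `(-1)^k` times the coefficient of `T^(m - k)` in
`(T - x + 1)_m`. It is set to `0` for `k > m`. -/
noncomputable def signedStirlingP (k m : ℕ) (x : ℂ) : ℂ :=
  if k ≤ m then
    (-1) ^ k * ((ascPochhammer ℂ m).comp
      (Polynomial.X + Polynomial.C (1 - x))).coeff (m - k)
  else 0

/-- The defining expansion of the signed generalized Stirling polynomials. -/
theorem signedStirlingP_generating (m : ℕ) (x j : ℂ) :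
    (ascPochhammer ℂ m).eval (j + 1) =
      ∑ k ∈ Finset.range (m + 1), (-1) ^ k * signedStirlingP k m x * (j + x) ^ (m - k) := by
  set p : Polynomial ℂ := (ascPochhammer ℂ m).comp (Polynomial.X + Polynomial.C (1 - x)) with hp
  have hd : p.natDegree < m + 1 := by
    have h1 : (Polynomial.X + Polynomial.C (1 - x)).natDegree = 1 :=
      Polynomial.natDegree_X_add_C _
    rw [hp, Polynomial.natDegree_comp, h1, ascPochhammer_natDegree]
    omega
  have he : p.eval (j + x) = (ascPochhammer ℂ m).eval (j + 1) := by
    rw [hp, Polynomial.eval_comp]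
    congr 1
    simp
  rw [← he, Polynomial.eval_eq_sum_range' hd, ← Finset.sum_range_reflect]
  refine Finset.sum_congr rfl fun k hk => ?_
  have hk' : k ≤ m := Nat.lt_succ_iff.mp (Finset.mem_range.mp hk)
  have h2 : m + 1 - 1 - k = m - k := by omega
  have h3 : ((-1 : ℂ) ^ k) * (-1) ^ k = 1 := by rw [← mul_pow]; simp
  rw [h2, signedStirlingP, if_pos hk', ← hp, ← mul_assoc, h3, one_mul]

/-- The Hurwitz zeta function `ζ(s, z)` for real `z > 0`, i.e. the analytic continuation in `s` of
`∑_{j ≥ 0} 1 / (j + z)^s`. Mathlib's `HurwitzZeta.hurwitzZeta` only sees `z` modulo `1` and is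
`∑_{j ≥ 0} 1 / (j + r)^s` with `r ∈ (0, 1]` the representative of `z` modulo `1`; the first
`⌈z⌉₊ - 1` terms, at the points `z - 1, z - 2, …, r`, are subtracted from it. -/
noncomputable def hurwitzZetaReal (s : ℂ) (z : ℝ) : ℂ :=
  HurwitzZeta.hurwitzZeta (z : UnitAddCircle) s -
    ∑ i ∈ Finset.range (⌈z⌉₊ - 1), 1 / (((z - (i + 1) : ℝ) : ℂ)) ^ s

/-- `ζ(s, z)` is given by the Hurwitz series for `Re s > 1`. -/
theorem hasSum_hurwitzZetaReal {z : ℝ} (hz : 0 < z) {s : ℂ} (hs : 1 < s.re) :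
    HasSum (fun j : ℕ => 1 / ((j : ℂ) + (z : ℂ)) ^ s) (hurwitzZetaReal s z) := by
  obtain ⟨m, hm⟩ : ∃ m : ℕ, ⌈z⌉₊ = m + 1 :=
    Nat.exists_eq_succ_of_ne_zero (Nat.ceil_pos.mpr hz).ne'
  have h1 : z ≤ (m : ℝ) + 1 := by
    have := Nat.le_ceil z
    rw [hm] at this
    exact_mod_cast this
  have h2 : (m : ℝ) < z := by
    apply Nat.lt_ceil.mp
    omega
  have hc : ((z - m : ℝ) : UnitAddCircle) = (z : UnitAddCircle) := by
    rw [AddCircle.coe_sub]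
    have : ((m : ℝ) : UnitAddCircle) = 0 := by
      rw [AddCircle.coe_eq_zero_iff]
      exact ⟨m, by simp⟩
    rw [this, sub_zero]
  have hsum := HurwitzZeta.hasSum_hurwitzZeta_of_one_lt_re (a := z - m)
    ⟨by linarith, by linarith⟩ hs
  rw [hc] at hsum
  rw [← hasSum_nat_add_iff' m] at hsum
  unfold hurwitzZetaReal
  rw [hm, Nat.add_sub_cancel]
  have e1 : (fun j : ℕ => 1 / ((j : ℂ) + (z : ℂ)) ^ s) =
      fun j : ℕ => 1 / (((j + m : ℕ) : ℂ) + ((z - m : ℝ) : ℂ)) ^ s := by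
    funext j
    congr 2
    push_cast
    ring
  have e2 : ∑ i ∈ Finset.range m, 1 / (((z - (i + 1) : ℝ) : ℂ)) ^ s =
      ∑ i ∈ Finset.range m, 1 / ((i : ℂ) + ((z - m : ℝ) : ℂ)) ^ s := by
    rw [← Finset.sum_range_reflect]
    refine Finset.sum_congr rfl fun i hi => ?_
    have hi' : i + 1 ≤ m := Finset.mem_range.mp hi
    have h4 : m - 1 - i = m - (i + 1) := by omega
    rw [h4]
    congr 2
    push_cast [Nat.cast_sub hi']
    ring
  rw [e1, e2]
  exact hsum

/-- Each of the subtracted terms is an entire function of `s`. -/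
theorem differentiable_hurwitzZetaReal_terms (z : ℝ) :
    Differentiable ℂ fun s : ℂ =>
      ∑ i ∈ Finset.range (⌈z⌉₊ - 1), 1 / (((z - (i + 1) : ℝ) : ℂ)) ^ s := by
  refine Differentiable.fun_sum fun i hi => ?_
  have hi' : i + 1 < ⌈z⌉₊ := by
    have := Finset.mem_range.mp hi
    omega
  have h2 : ((i + 1 : ℕ) : ℝ) < z := Nat.lt_ceil.mp hi'
  have hne : (((z - (i + 1) : ℝ) : ℂ)) ≠ 0 := by
    rw [Complex.ofReal_ne_zero]
    push_cast at h2
    linarith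
  have hd : Differentiable ℂ fun s : ℂ => (((z - (i + 1) : ℝ) : ℂ)) ^ s :=
    fun s => (differentiableAt_id.const_cpow (Or.inl hne))
  exact (differentiable_const _).div hd fun s => by
    rw [Complex.cpow_def_of_ne_zero hne]
    exact Complex.exp_ne_zero _

/-- `ζ(s, z)` is holomorphic in `s` away from `s = 1`. -/
theorem differentiableAt_hurwitzZetaReal (z : ℝ) {s : ℂ} (hs : s ≠ 1) :
    DifferentiableAt ℂ (fun s => hurwitzZetaReal s z) s :=
  (HurwitzZeta.differentiableAt_hurwitzZeta _ hs).sub (differentiable_hurwitzZetaReal_terms z s)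

/-- The difference `s ↦ ζ(s, z) - ζ(s, w)` of two Hurwitz zeta functions, extended to `s = 1`,
where the two simple poles cancel, by its limit. -/
noncomputable def hurwitzZetaDiff (z w : ℝ) : ℂ → ℂ :=
  Function.update (fun s => hurwitzZetaReal s z - hurwitzZetaReal s w) 1
    (Filter.limUnder (𝓝[≠] 1) fun s => hurwitzZetaReal s z - hurwitzZetaReal s w)

/-- Away from `s = 1` the difference is the plain one. -/
theorem hurwitzZetaDiff_of_ne (z w : ℝ) {s : ℂ} (hs : s ≠ 1) :
    hurwitzZetaDiff z w s = hurwitzZetaReal s z - hurwitzZetaReal s w :=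
  Function.update_of_ne hs _ _

/-- The extended difference is an entire function. -/
theorem differentiable_hurwitzZetaDiff (z w : ℝ) :
    Differentiable ℂ (hurwitzZetaDiff z w) := by
  have h : Differentiable ℂ fun s => hurwitzZetaReal s z - hurwitzZetaReal s w := by
    have h0 : Differentiable ℂ fun s : ℂ =>
        (HurwitzZeta.hurwitzZeta (z : UnitAddCircle) s -
          HurwitzZeta.hurwitzZeta (w : UnitAddCircle) s) -
        ((∑ i ∈ Finset.range (⌈z⌉₊ - 1), 1 / (((z - (i + 1) : ℝ) : ℂ)) ^ s) -
          ∑ i ∈ Finset.range (⌈w⌉₊ - 1), 1 / (((w - (i + 1) : ℝ) : ℂ)) ^ s) :=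
      (HurwitzZeta.differentiable_hurwitzZeta_sub_hurwitzZeta _ _).fun_sub
        ((differentiable_hurwitzZetaReal_terms z).fun_sub (differentiable_hurwitzZetaReal_terms w))
    have e : (fun s => hurwitzZetaReal s z - hurwitzZetaReal s w) = fun s : ℂ =>
        (HurwitzZeta.hurwitzZeta (z : UnitAddCircle) s -
          HurwitzZeta.hurwitzZeta (w : UnitAddCircle) s) -
        ((∑ i ∈ Finset.range (⌈z⌉₊ - 1), 1 / (((z - (i + 1) : ℝ) : ℂ)) ^ s) -
          ∑ i ∈ Finset.range (⌈w⌉₊ - 1), 1 / (((w - (i + 1) : ℝ) : ℂ)) ^ s) := by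
      funext s
      simp only [hurwitzZetaReal]
      ring
    rw [e]
    exact h0
  have hl : Filter.Tendsto (fun s => hurwitzZetaReal s z - hurwitzZetaReal s w) (𝓝[≠] 1)
      (𝓝 (hurwitzZetaReal 1 z - hurwitzZetaReal 1 w)) :=
    (h 1).continuousAt.tendsto.mono_left nhdsWithin_le_nhds
  unfold hurwitzZetaDiff
  rw [hl.limUnder_eq]
  convert h using 1
  exact Function.update_eq_self 1 _

/-- Away from `s = 1` the derivative of the difference is `ζ'(s, z) - ζ'(s, w)`. -/
theorem deriv_hurwitzZetaDiff_of_ne (z w : ℝ) {s : ℂ} (hs : s ≠ 1) :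
    deriv (hurwitzZetaDiff z w) s =
      deriv (fun t => hurwitzZetaReal t z) s - deriv (fun t => hurwitzZetaReal t w) s := by
  have he : hurwitzZetaDiff z w =ᶠ[𝓝 s] fun t => hurwitzZetaReal t z - hurwitzZetaReal t w := by
    filter_upwards [isOpen_ne.mem_nhds hs] with t ht
    exact hurwitzZetaDiff_of_ne z w ht
  rw [he.deriv_eq]
  exact deriv_fun_sub (differentiableAt_hurwitzZetaReal z hs)
    (differentiableAt_hurwitzZetaReal w hs)

/-!
The integral is a derivative of a Mellin transform. Let `n = m + 1` and
`M(s) = ∫₀^∞ t^(s - 1) sech^n (b t) dt`. Since `sech (b t)` is bounded near `0` and decays exponentially,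
`M` is holomorphic for `Re s > 0`, and `M'(1) = ∫₀^∞ log t sech^n (b t) dt` converges absolutely. So the
integral in question is `log a * M(1) + M'(1)`.

For `Re s > n` the binomial series of `sech^n` (`hasSum_csech_pow`) may be integrated term by term, with
the Gamma integral for a complex rate (`integral_cpow_mul_cexp_neg_mul`). This gives
`M(s)` as `2^n Γ(s) ∑ (-1)^j (j + m).choose m ((2 j + n) b)^(-s)` (`hasSum_mellin_csech_pow`). The signed
Stirling polynomials at `n / 2` expand the binomial coefficient in powers of `j + n / 2`, and an
alternating series `∑ (-1)^j (j + x)^(-w)` is `2^(-w) (ζ(w, x / 2) - ζ(w, (x + 1) / 2))`. Hence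
`M(s) = 2^(2 m + 1) / m! * Γ(s) (4 b)^(-s) * sechZeta m s`, where `sechZeta` is entire. Both sides are
holomorphic for `Re s > 0`, so the identity extends to that half-plane (`mellin_csech_pow`).

The logarithmic derivative at `s = 1` of `Γ(s) (4 b)^(-s)` is `-γ - log 4 - log b`, which explains the
constants in the result (`hasDerivAt_mellin_csech_pow_one`). The remaining multiple of `M(1)` is evaluated
independently: `b M(1)` does not depend on `b`, and for `b = 1` the integral of `sech^n` is
`2^(n - 2) Γ(n / 2)^2 / (n - 1)!`, by the two-step recursion in `n` (`integral_inv_cosh_pow`).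
-/

/-! ### The Gamma integral with a complex rate -/

theorem integrableOn_cpow_mul_cexp_neg_mul {a r : ℂ} (ha : 0 < a.re) (hr : 0 < r.re) :
    MeasureTheory.IntegrableOn (fun t : ℝ => (t : ℂ) ^ (a - 1) * Complex.exp (-(r * t)))
      (Set.Ioi 0) := by
  have h := integrableOn_rpow_mul_exp_neg_mul_rpow (p := 1) (s := a.re - 1) (b := r.re)
    (by linarith) one_pos hr
  refine MeasureTheory.Integrable.mono' h ?_ ?_
  · refine ContinuousOn.aestronglyMeasurable ?_ measurableSet_Ioi
    intro t ht
    refine ContinuousAt.continuousWithinAt ?_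
    have : (t : ℂ) ∈ Complex.slitPlane := Complex.ofReal_mem_slitPlane.2 ht
    have h1 : ContinuousAt (fun t : ℝ => (t : ℂ) ^ (a - 1)) t :=
      (continuousAt_cpow_const this).comp Complex.continuous_ofReal.continuousAt
    exact h1.mul (by fun_prop)
  · filter_upwards [MeasureTheory.ae_restrict_mem measurableSet_Ioi] with t ht
    rw [norm_mul, Complex.norm_cpow_eq_rpow_re_of_pos ht, Complex.norm_exp]
    simp

/-- Differentiation under the integral sign, dominated on the half-plane `r.re / 2 < w.re`. -/
theorem differentiableAt_integral_cpow_mul_cexp_neg_mul {a r : ℂ} (ha : 0 < a.re) (hr : 0 < r.re) :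
    DifferentiableAt ℂ
      (fun r : ℂ => ∫ t : ℝ in Set.Ioi 0, (t : ℂ) ^ (a - 1) * Complex.exp (-(r * t))) r := by
  have hU : {w : ℂ | r.re / 2 < w.re} ∈ 𝓝 r :=
    (isOpen_lt continuous_const Complex.continuous_re).mem_nhds (by
      change r.re / 2 < r.re; linarith)
  have hb := integrableOn_rpow_mul_exp_neg_mul_rpow (p := 1) (s := a.re) (b := r.re / 2)
    (by linarith) one_pos (by linarith)
  refine (hasDerivAt_integral_of_dominated_loc_of_deriv_le
    (μ := MeasureTheory.volume.restrict (Set.Ioi (0 : ℝ)))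
    (F := fun (r : ℂ) (t : ℝ) => (t : ℂ) ^ (a - 1) * Complex.exp (-(r * t)))
    (F' := fun (w : ℂ) (t : ℝ) => (t : ℂ) ^ (a - 1) * (Complex.exp (-(w * t)) * (-t)))
    hU ?_ (integrableOn_cpow_mul_cexp_neg_mul ha hr) ?_ ?_ hb ?_).2.differentiableAt
  · filter_upwards [hU] with w hw
    exact (integrableOn_cpow_mul_cexp_neg_mul ha (lt_trans (by linarith) hw)).aestronglyMeasurable
  · have := (integrableOn_cpow_mul_cexp_neg_mul ha hr).aestronglyMeasurable
    have h2 := this.mul (g := fun t : ℝ => (-t : ℂ)) (by fun_prop)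
    refine h2.congr (Filter.Eventually.of_forall fun t => ?_)
    simp only [Pi.mul_apply]
    ring
  · filter_upwards [MeasureTheory.ae_restrict_mem measurableSet_Ioi] with t ht w hw
    have ht' : (0 : ℝ) < t := ht
    have hw' : r.re / 2 < w.re := hw
    rw [norm_mul, norm_mul, Complex.norm_cpow_eq_rpow_re_of_pos ht, Complex.norm_exp, norm_neg,
      Complex.norm_real, Real.norm_of_nonneg ht'.le, Real.rpow_one]
    have e : t ^ (a - 1).re * t = t ^ a.re := by
      rw [Complex.sub_re, Complex.one_re, ← Real.rpow_add_one ht'.ne', sub_add_cancel]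
    calc t ^ (a - 1).re * (Real.exp (-(w * t)).re * t)
        = t ^ a.re * Real.exp (-(w * t)).re := by rw [← e]; ring
      _ ≤ t ^ a.re * Real.exp (-(r.re / 2) * t) := by
        gcongr
        simp only [Complex.neg_re, Complex.re_mul_ofReal]
        nlinarith
  · refine Filter.Eventually.of_forall fun t w _ => ?_
    refine HasDerivAt.const_mul _ ?_
    have h1 : HasDerivAt (fun w : ℂ => -(w * (t : ℂ))) (-(1 * (t : ℂ))) w :=
      ((hasDerivAt_id w).mul_const _).neg
    simpa using h1.cexp

/-- Both sides are holomorphic in the rate `r` and agree for `r > 0`. -/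
theorem integral_cpow_mul_cexp_neg_mul {a r : ℂ} (ha : 0 < a.re) (hr : 0 < r.re) :
    ∫ t : ℝ in Set.Ioi 0, (t : ℂ) ^ (a - 1) * Complex.exp (-(r * t)) =
      r ^ (-a) * Complex.Gamma a := by
  have hopen : IsOpen {w : ℂ | 0 < w.re} := isOpen_lt continuous_const Complex.continuous_re
  have hf : AnalyticOnNhd ℂ
      (fun r : ℂ => ∫ t : ℝ in Set.Ioi 0, (t : ℂ) ^ (a - 1) * Complex.exp (-(r * t)))
      {w : ℂ | 0 < w.re} :=
    DifferentiableOn.analyticOnNhd (fun w hw =>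
      (differentiableAt_integral_cpow_mul_cexp_neg_mul ha hw).differentiableWithinAt) hopen
  have hg : AnalyticOnNhd ℂ (fun r : ℂ => r ^ (-a) * Complex.Gamma a) {w : ℂ | 0 < w.re} := by
    refine DifferentiableOn.analyticOnNhd (fun w hw => ?_) hopen
    have h1 : DifferentiableAt ℂ (fun r : ℂ => r ^ (-a)) w :=
      differentiableAt_id.cpow_const (Or.inl hw)
    exact (h1.mul_const _).differentiableWithinAt
  have hpre : IsPreconnected {w : ℂ | 0 < w.re} :=
    (convex_halfSpace_re_gt 0).isPreconnected
  refine hf.eqOn_of_preconnected_of_frequently_eq hg hpre (z₀ := 1) (by simp) ?_ hr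
  -- the positive reals accumulate at `1`
  have hseq : Filter.Tendsto (fun x : ℝ => (x : ℂ)) (𝓝[>] 1) (𝓝[≠] 1) := by
    refine tendsto_nhdsWithin_iff.2 ⟨?_, ?_⟩
    · have := Complex.continuous_ofReal.tendsto 1
      rw [Complex.ofReal_one] at this
      exact this.mono_left nhdsWithin_le_nhds
    · filter_upwards [self_mem_nhdsWithin] with x hx
      have : x ≠ 1 := ne_of_gt hx
      simpa using this
  refine hseq.frequently (Filter.Eventually.frequently ?_)
  filter_upwards [self_mem_nhdsWithin] with x hx
  have hx0 : (0 : ℝ) < x := lt_trans one_pos hx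
  rw [Complex.integral_cpow_mul_exp_neg_mul_Ioi ha hx0, one_div,
    Complex.inv_cpow_ofReal_nonneg hx0.le, Complex.cpow_neg]

/-! ### Alternating Hurwitz series -/

/-- No branch problem arises, because multiplying by `c > 0` preserves the argument. -/
theorem ofReal_mul_cpow {c : ℝ} (hc : 0 < c) {z : ℂ} (hz : z ≠ 0) (s : ℂ) :
    ((c : ℂ) * z) ^ s = (c : ℂ) ^ s * z ^ s := by
  have hc' : (c : ℂ) ≠ 0 := Complex.ofReal_ne_zero.2 hc.ne'
  rw [Complex.cpow_def_of_ne_zero (mul_ne_zero hc' hz), Complex.cpow_def_of_ne_zero hc',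
    Complex.cpow_def_of_ne_zero hz, ← Complex.exp_add, Complex.log_ofReal_mul hc hz,
    Complex.ofReal_log hc.le, add_mul]

/-- The even and the odd terms are `2 ^ (-w)` times Hurwitz series at `x / 2` and `(x + 1) / 2`. -/
theorem hasSum_neg_one_pow_mul_cpow {x : ℝ} (hx : 0 < x) {w : ℂ} (hw : 1 < w.re) :
    HasSum (fun j : ℕ => (-1 : ℂ) ^ j * ((j : ℂ) + x) ^ (-w))
      (2 ^ (-w) * hurwitzZetaDiff (x / 2) ((x + 1) / 2) w) := by
  have hw1 : w ≠ 1 := by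
    rintro rfl
    simp at hw
  rw [hurwitzZetaDiff_of_ne _ _ hw1, mul_sub, sub_eq_add_neg, ← mul_neg]
  have key : ∀ (y : ℝ), 0 < y → ∀ i : ℕ,
      (2 : ℂ) ^ (-w) * (1 / ((i : ℂ) + ((y / 2 : ℝ) : ℂ)) ^ w) = (2 * (i : ℂ) + y) ^ (-w) := by
    intro y hy i
    have hne : ((i : ℂ) + ((y / 2 : ℝ) : ℂ)) ≠ 0 := by
      have : ((i : ℝ) + y / 2) ≠ 0 := by positivity
      exact_mod_cast this
    have h := ofReal_mul_cpow two_pos hne (-w)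
    rw [one_div, ← Complex.cpow_neg]
    push_cast at h ⊢
    rw [← h]
    congr 1
    ring
  refine HasSum.even_add_odd ?_ ?_
  · convert! (hasSum_hurwitzZetaReal (half_pos hx) hw).mul_left ((2 : ℂ) ^ (-w)) using 2 with i
    rw [key x hx i]
    simp
  · convert! ((hasSum_hurwitzZetaReal (z := (x + 1) / 2) (by positivity) hw).neg).mul_left
      ((2 : ℂ) ^ (-w)) using 2 with i
    rw [mul_neg, key (x + 1) (by positivity) i]
    rw [pow_succ, pow_mul]
    push_cast
    simp only [even_two, Even.neg_pow, one_pow]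
    rw [show (2 * (i : ℂ) + 1 + x) = 2 * i + (x + 1) by ring]
    ring

/-! ### The exponential expansion of powers of the hyperbolic secant -/

theorem cosh_ne_zero_of_re_pos {z : ℂ} (hz : 0 < z.re) : Complex.cosh z ≠ 0 := by
  intro h
  have h1 : Complex.exp z = -Complex.exp (-z) := by
    rw [Complex.cosh] at h
    linear_combination 2 * h
  have h2 := congrArg norm h1
  rw [norm_neg, Complex.norm_exp, Complex.norm_exp, Real.exp_eq_exp, Complex.neg_re] at h2
  linarith

/-- Binomial series of `(2 e^{-z} / (1 + e^{-2z}))^(m + 1)`. -/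
theorem hasSum_csech_pow (m : ℕ) {z : ℂ} (hz : 0 < z.re) :
    HasSum (fun j : ℕ => (2 : ℂ) ^ (m + 1) * ((-1) ^ j * ((j + m).choose m : ℂ)) *
      Complex.exp (-((2 * j + m + 1) * z))) (csech z ^ (m + 1)) := by
  have hr : ‖-Complex.exp (-(2 * z))‖ < 1 := by
    rw [norm_neg, Complex.norm_exp, Real.exp_lt_one_iff]
    simpa using hz
  have h := (hasSum_choose_mul_geometric_of_norm_lt_one m hr).mul_left
    ((2 * Complex.exp (-z)) ^ (m + 1))
  convert! h using 1
  · funext j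
    rw [neg_pow (Complex.exp _), mul_pow, ← Complex.exp_nat_mul, ← Complex.exp_nat_mul]
    have : Complex.exp (-((2 * j + m + 1) * z)) =
        Complex.exp (((m + 1 : ℕ) : ℂ) * -z) * Complex.exp ((j : ℂ) * -(2 * z)) := by
      rw [← Complex.exp_add]
      congr 1
      push_cast
      ring
    rw [this]
    ring
  · rw [mul_one_div, ← div_pow]
    congr 1
    have hc := cosh_ne_zero_of_re_pos hz
    rw [Complex.cosh] at hc
    have hc' : Complex.exp z + Complex.exp (-z) ≠ 0 := by
      intro h0
      rw [h0] at hc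
      simp at hc
    have e2 : 1 - -Complex.exp (-(2 * z)) = Complex.exp (-z) * (Complex.exp z + Complex.exp (-z)) := by
      rw [mul_add, ← Complex.exp_add, ← Complex.exp_add, neg_add_cancel, Complex.exp_zero]
      rw [show -z + -z = -(2 * z) by ring]
      ring
    have he := Complex.exp_ne_zero (-z)
    rw [e2, csech, Complex.cosh]
    field_simp

/-- The binomial coefficient is `O(j ^ m)`, which fixes the half-plane of absolute convergence. -/
theorem summable_choose_mul_rpow (m : ℕ) {σ : ℝ} (hσ : (m : ℝ) + 1 < σ) :
    Summable fun j : ℕ => ((j + m).choose m : ℝ) * (2 * (j : ℝ) + m + 1) ^ (-σ) := by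
  have hs : Summable fun j : ℕ => ((j : ℝ) + 1) ^ ((m : ℝ) - σ) := by
    have h := (summable_nat_add_iff 1).2 (Real.summable_nat_rpow.2 (show (m : ℝ) - σ < -1 by linarith))
    simpa using h
  refine Summable.of_nonneg_of_le (fun j => by positivity) (fun j => ?_) hs
  have hpos : (0 : ℝ) < 2 * (j : ℝ) + m + 1 := by positivity
  calc ((j + m).choose m : ℝ) * (2 * (j : ℝ) + m + 1) ^ (-σ)
      ≤ (2 * (j : ℝ) + m + 1) ^ m * (2 * (j : ℝ) + m + 1) ^ (-σ) := by
        gcongr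
        calc ((j + m).choose m : ℝ) ≤ ((j + m : ℕ) : ℝ) ^ m := by
              exact_mod_cast Nat.choose_le_pow (j + m) m
          _ ≤ _ := by
              gcongr
              push_cast
              have : (0 : ℝ) ≤ j := by positivity
              linarith
    _ = (2 * (j : ℝ) + m + 1) ^ ((m : ℝ) - σ) := by
        rw [← Real.rpow_natCast, ← Real.rpow_add hpos, sub_eq_add_neg]
    _ ≤ ((j : ℝ) + 1) ^ ((m : ℝ) - σ) := by
        refine Real.rpow_le_rpow_of_nonpos (by positivity) ?_ (by linarith)
        have : (0 : ℝ) ≤ j := by positivity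
        have : (0 : ℝ) ≤ m := by positivity
        linarith

/-! ### The Mellin transform as a Dirichlet series -/

/-- Termwise integration of the binomial series. It is justified for `m + 1 < s.re`, where the
integrals of the norms are summable. -/
theorem hasSum_mellin_csech_pow (m : ℕ) {b s : ℂ} (hb : 0 < b.re) (hs : (m : ℝ) + 1 < s.re) :
    HasSum (fun j : ℕ => (2 : ℂ) ^ (m + 1) * ((-1) ^ j * ((j + m).choose m : ℂ)) *
        (((2 * j + m + 1) * b) ^ (-s) * Complex.Gamma s))
      (mellin (fun t : ℝ => csech (b * t) ^ (m + 1)) s) := by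
  have hs0 : 0 < s.re := by
    have : (0 : ℝ) ≤ m := by positivity
    linarith
  have hre : ∀ j : ℕ, ((2 * j + m + 1) * b : ℂ).re = (2 * (j : ℝ) + m + 1) * b.re := by
    intro j
    have := Complex.re_ofReal_mul (2 * (j : ℝ) + m + 1) b
    push_cast at this
    exact this
  have hrpos : ∀ j : ℕ, 0 < ((2 * j + m + 1) * b : ℂ).re := by
    intro j
    rw [hre]
    positivity
  set F : ℕ → ℝ → ℂ := fun j t => (2 : ℂ) ^ (m + 1) * ((-1) ^ j * ((j + m).choose m : ℂ)) *
    ((t : ℂ) ^ (s - 1) * Complex.exp (-((2 * j + m + 1) * b * t))) with hF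
  have hint : ∀ j, MeasureTheory.Integrable (F j)
      (MeasureTheory.volume.restrict (Set.Ioi 0)) := fun j =>
    (integrableOn_cpow_mul_cexp_neg_mul hs0 (hrpos j)).const_mul _
  have hnorm : ∀ j, ∫ t in Set.Ioi (0 : ℝ), ‖F j t‖ =
      (2 : ℝ) ^ (m + 1) * b.re ^ (-s.re) * Real.Gamma s.re *
        (((j + m).choose m : ℝ) * (2 * (j : ℝ) + m + 1) ^ (-s.re)) := by
    intro j
    have hp : (0 : ℝ) < (2 * (j : ℝ) + m + 1) * b.re := by positivity
    have e : ∀ t ∈ Set.Ioi (0 : ℝ), ‖F j t‖ = (2 : ℝ) ^ (m + 1) * ((j + m).choose m : ℝ) *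
        (t ^ (s.re - 1) * Real.exp (-((2 * (j : ℝ) + m + 1) * b.re * t))) := by
      intro t ht
      simp only [hF]
      rw [norm_mul, norm_mul, norm_mul, norm_mul, Complex.norm_cpow_eq_rpow_re_of_pos ht,
        Complex.norm_exp, Complex.neg_re, Complex.re_mul_ofReal, hre]
      simp
    rw [MeasureTheory.setIntegral_congr_fun measurableSet_Ioi e,
      MeasureTheory.integral_const_mul, Real.integral_rpow_mul_exp_neg_mul_Ioi hs0 hp,
      one_div, Real.inv_rpow hp.le, ← Real.rpow_neg hp.le, Real.mul_rpow (by positivity) hb.le]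
    ring
  have hsum : Summable fun j => ∫ t in Set.Ioi (0 : ℝ), ‖F j t‖ := by
    simp_rw [hnorm]
    exact (summable_choose_mul_rpow m hs).mul_left _
  have h := MeasureTheory.hasSum_integral_of_summable_integral_norm hint hsum
  have e1 : ∫ t in Set.Ioi (0 : ℝ), ∑' j, F j t =
      mellin (fun t : ℝ => csech (b * t) ^ (m + 1)) s := by
    refine MeasureTheory.setIntegral_congr_fun measurableSet_Ioi fun t ht => ?_
    have ht0 : (0 : ℝ) < t := ht
    have hz : 0 < (b * t).re := by
      rw [Complex.re_mul_ofReal]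
      positivity
    have h2 := (hasSum_csech_pow m hz).mul_left ((t : ℂ) ^ (s - 1))
    rw [smul_eq_mul, ← h2.tsum_eq]
    refine tsum_congr fun j => ?_
    simp only [hF]
    rw [mul_assoc _ b]
    ring
  rw [e1] at h
  convert! h using 2 with j
  simp only [hF]
  rw [MeasureTheory.integral_const_mul, integral_cpow_mul_cexp_neg_mul hs0 (hrpos j)]

/-- The Stirling expansion at a natural number `j`, where `(j + 1)_m = m! * (j + m).choose m`. -/
theorem factorial_mul_choose_eq_sum_signedStirlingP (m j : ℕ) (x : ℂ) :
    (m.factorial : ℂ) * ((j + m).choose m : ℂ) =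
      ∑ k ∈ Finset.range (m + 1), (-1) ^ k * signedStirlingP k m x * ((j : ℂ) + x) ^ (m - k) := by
  rw [← signedStirlingP_generating]
  have h : (((ascPochhammer ℕ m).eval (j + 1) : ℕ) : ℂ) = (ascPochhammer ℂ m).eval ((j : ℂ) + 1) := by
    rw [ascPochhammer_eval_cast, Nat.cast_succ]
  rw [← h, ascPochhammer_nat_eq_ascFactorial, Nat.ascFactorial_eq_factorial_mul_choose]
  push_cast
  ring

/-- The combination of differences of Hurwitz zeta functions by which the Mellin transform of
`sech^(m + 1)` is expressed: the Dirichlet series `∑ (-1)^j (j + 1)_m (j + (m + 1) / 2)^(-s)`, with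
`(j + 1)_m` expanded in powers of `j + (m + 1) / 2`, up to the factor `2 ^ (m - s)`. The exponent is
`n = m + 1`, so that no truncated subtraction occurs. -/
noncomputable def sechZeta (m : ℕ) (s : ℂ) : ℂ :=
  ∑ k ∈ Finset.range (m + 1), (-1 / 2 : ℂ) ^ k * signedStirlingP k m (((m : ℂ) + 1) / 2) *
    hurwitzZetaDiff (((m : ℝ) + 1) / 4) (((m : ℝ) + 1 + 2) / 4) (s + k - m)

theorem differentiable_sechZeta (m : ℕ) : Differentiable ℂ (sechZeta m) := by
  unfold sechZeta
  refine Differentiable.fun_sum fun k _ => Differentiable.const_mul ?_ _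
  exact (differentiable_hurwitzZetaDiff _ _).comp
    (((differentiable_id).add_const _).sub_const _)

/-- Expanding the binomial coefficients in powers of `j + (m + 1) / 2` turns the Dirichlet series into
`m + 1` alternating Hurwitz series, all absolutely convergent for `m + 1 < s.re`. -/
theorem mellin_csech_pow_of_lt_re (m : ℕ) {b s : ℂ} (hb : 0 < b.re) (hs : (m : ℝ) + 1 < s.re) :
    mellin (fun t : ℝ => csech (b * t) ^ (m + 1)) s =
      (2 : ℂ) ^ (2 * m + 1) / (m.factorial : ℂ) * Complex.Gamma s * (4 * b) ^ (-s) *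
        sechZeta m s := by
  have hb0 : b ≠ 0 := by
    rintro rfl
    simp at hb
  have hx : (0 : ℝ) < ((m : ℝ) + 1) / 2 := by positivity
  have hk : ∀ k ∈ Finset.range (m + 1), HasSum
      (fun j : ℕ => (-1) ^ k * signedStirlingP k m (((m : ℂ) + 1) / 2) *
        ((-1 : ℂ) ^ j * ((j : ℂ) + ((((m : ℝ) + 1) / 2 : ℝ) : ℂ)) ^ (-(s + k - m))))
      ((-1) ^ k * signedStirlingP k m (((m : ℂ) + 1) / 2) * (2 ^ (-(s + k - m)) *
        hurwitzZetaDiff (((m : ℝ) + 1) / 4) (((m : ℝ) + 1 + 2) / 4) (s + k - m))) := by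
    intro k _
    have hw : 1 < (s + k - m).re := by
      have : (0 : ℝ) ≤ k := by positivity
      simp only [Complex.sub_re, Complex.add_re, Complex.natCast_re]
      linarith
    have h := hasSum_neg_one_pow_mul_cpow hx hw
    rw [show ((m : ℝ) + 1) / 2 / 2 = ((m : ℝ) + 1) / 4 by ring,
      show (((m : ℝ) + 1) / 2 + 1) / 2 = ((m : ℝ) + 1 + 2) / 4 by ring] at h
    exact h.mul_left _
  have hS := (hasSum_sum hk).mul_left
    ((2 : ℂ) ^ (m + 1) / (m.factorial : ℂ) * Complex.Gamma s * (2 * b) ^ (-s))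
  refine (hasSum_mellin_csech_pow m hb hs).unique ?_
  convert! hS using 1
  · funext j
    have hy0 : (0 : ℝ) < (j : ℝ) + ((m : ℝ) + 1) / 2 := by positivity
    have hyc : ((j : ℂ) + ((((m : ℝ) + 1) / 2 : ℝ) : ℂ)) ≠ 0 := by exact_mod_cast hy0.ne'
    have e1 : ((2 * (j : ℂ) + m + 1) * b) ^ (-s) =
        ((j : ℂ) + ((((m : ℝ) + 1) / 2 : ℝ) : ℂ)) ^ (-s) * (2 * b) ^ (-s) := by
      have h := ofReal_mul_cpow hy0 (mul_ne_zero two_ne_zero hb0) (-s)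
      rw [Complex.ofReal_add, Complex.ofReal_natCast] at h
      rw [← h]
      congr 1
      push_cast
      ring
    have e2 : ∑ k ∈ Finset.range (m + 1), (-1) ^ k * signedStirlingP k m (((m : ℂ) + 1) / 2) *
        ((-1 : ℂ) ^ j * ((j : ℂ) + ((((m : ℝ) + 1) / 2 : ℝ) : ℂ)) ^ (-(s + k - m))) =
        (-1 : ℂ) ^ j * ((j : ℂ) + ((((m : ℝ) + 1) / 2 : ℝ) : ℂ)) ^ (-s) *
          ((m.factorial : ℂ) * ((j + m).choose m : ℂ)) := by
      rw [factorial_mul_choose_eq_sum_signedStirlingP m j (((m : ℂ) + 1) / 2), Finset.mul_sum]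
      refine Finset.sum_congr rfl fun k hk' => ?_
      have hkm : k ≤ m := Nat.lt_succ_iff.mp (Finset.mem_range.mp hk')
      have : -(s + k - m) = -s + ((m - k : ℕ) : ℂ) := by
        push_cast [Nat.cast_sub hkm]
        ring
      rw [this, Complex.cpow_add _ _ hyc, Complex.cpow_natCast]
      push_cast
      ring
    rw [e1, e2]
    have hf : (m.factorial : ℂ) ≠ 0 := Nat.cast_ne_zero.2 m.factorial_ne_zero
    field_simp
  · rw [sechZeta, Finset.mul_sum, Finset.mul_sum]
    refine Finset.sum_congr rfl fun k hk' => ?_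
    have e3 : (4 * b) ^ (-s) = (2 : ℂ) ^ (-s) * (2 * b) ^ (-s) := by
      have h := ofReal_mul_cpow two_pos (mul_ne_zero two_ne_zero hb0) (-s)
      push_cast at h
      rw [← h]
      congr 1
      ring
    have e4 : (2 : ℂ) ^ (-(s + k - m)) = 2 ^ (-s) * (1 / 2) ^ k * 2 ^ m := by
      rw [show -(s + k - m) = -s + -(k : ℂ) + (m : ℂ) by ring, Complex.cpow_add _ _ two_ne_zero,
        Complex.cpow_add _ _ two_ne_zero, Complex.cpow_neg _ (k : ℂ), Complex.cpow_natCast,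
        Complex.cpow_natCast, one_div, inv_pow]
    rw [e3, e4, show (-1 / 2 : ℂ) ^ k = (-1) ^ k * (1 / 2) ^ k by rw [← mul_pow]; norm_num]
    ring

/-! ### Analytic continuation to the right half-plane -/

theorem continuousOn_csech_pow (n : ℕ) {b : ℂ} (hb : 0 < b.re) :
    ContinuousOn (fun t : ℝ => csech (b * t) ^ n) (Set.Ici 0) := by
  unfold csech
  refine ContinuousOn.pow (ContinuousOn.div continuousOn_const ?_ ?_) n
  · exact (Complex.continuous_cosh.comp (by fun_prop)).continuousOn
  · intro t ht
    rcases (show (0 : ℝ) ≤ t from ht).eq_or_lt with rfl | h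
    · simp
    · refine cosh_ne_zero_of_re_pos ?_
      rw [Complex.re_mul_ofReal]
      positivity

theorem norm_csech_le {z : ℂ} (hz : 1 ≤ z.re) : ‖csech z‖ ≤ 4 * Real.exp (-z.re) := by
  have h1 : Real.exp z.re - Real.exp (-z.re) ≤ ‖Complex.exp z + Complex.exp (-z)‖ := by
    have := norm_sub_le_norm_add (Complex.exp z) (Complex.exp (-z))
    rwa [Complex.norm_exp, Complex.norm_exp, Complex.neg_re] at this
  have h2 : Real.exp (-z.re) ≤ 1 := Real.exp_le_one_iff.2 (by linarith)
  have h3 : 2 ≤ Real.exp z.re := by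
    have := Real.add_one_le_exp z.re
    linarith
  have h4 : Real.exp z.re / 2 ≤ ‖Complex.exp z + Complex.exp (-z)‖ := by linarith
  rw [csech, Complex.cosh, norm_div, norm_div, norm_one, Complex.norm_two, Real.exp_neg,
    one_div_div, ← div_eq_mul_inv, div_le_div_iff₀ (by linarith [Real.exp_pos z.re]) (Real.exp_pos _)]
  linarith

theorem csech_pow_isBigO_exp (m : ℕ) {b : ℂ} (hb : 0 < b.re) :
    (fun t : ℝ => csech (b * t) ^ (m + 1)) =O[Filter.atTop] fun t => Real.exp (-b.re * t) := by
  have h1 : (fun t : ℝ => csech (b * t)) =O[Filter.atTop] fun t => Real.exp (-b.re * t) := by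
    refine Asymptotics.IsBigO.of_bound 4 ?_
    filter_upwards [Filter.eventually_ge_atTop (1 / b.re)] with t ht
    have hre : (b * t).re = b.re * t := Complex.re_mul_ofReal _ _
    have := norm_csech_le (z := b * t) (by rw [hre]; rwa [div_le_iff₀' hb] at ht)
    rw [hre] at this
    rwa [Real.norm_of_nonneg (Real.exp_pos _).le, neg_mul]
  refine (h1.pow (m + 1)).trans (Asymptotics.IsBigO.of_bound 1 ?_)
  filter_upwards [Filter.eventually_ge_atTop 0] with t ht
  rw [norm_pow, one_mul, pow_succ]
  refine mul_le_of_le_one_left (norm_nonneg _) (pow_le_one₀ (norm_nonneg _) ?_)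
  rw [Real.norm_of_nonneg (Real.exp_pos _).le, Real.exp_le_one_iff]
  nlinarith

theorem csech_pow_isBigO_rpow_zero (n : ℕ) {b : ℂ} (hb : 0 < b.re) :
    (fun t : ℝ => csech (b * t) ^ n) =O[𝓝[>] 0] fun t => t ^ (-0 : ℝ) := by
  have h := ((continuousOn_csech_pow n hb) 0 Set.self_mem_Ici).mono Set.Ioi_subset_Ici_self
  simpa using h.tendsto.isBigO_one ℝ

theorem locallyIntegrableOn_csech_pow (n : ℕ) {b : ℂ} (hb : 0 < b.re) :
    MeasureTheory.LocallyIntegrableOn (fun t : ℝ => csech (b * t) ^ n) (Set.Ioi 0) :=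
  ((continuousOn_csech_pow n hb).mono Set.Ioi_subset_Ici_self).locallyIntegrableOn
    measurableSet_Ioi

/-- The closed form holds on the whole half-plane `0 < s.re`, by the identity theorem. -/
theorem mellin_csech_pow (m : ℕ) {b s : ℂ} (hb : 0 < b.re) (hs : 0 < s.re) :
    mellin (fun t : ℝ => csech (b * t) ^ (m + 1)) s =
      (2 : ℂ) ^ (2 * m + 1) / (m.factorial : ℂ) * Complex.Gamma s * (4 * b) ^ (-s) *
        sechZeta m s := by
  have hb4 : 4 * b ≠ 0 := by
    refine mul_ne_zero (by norm_num) ?_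
    rintro rfl
    simp at hb
  have hopen : IsOpen {w : ℂ | 0 < w.re} := isOpen_lt continuous_const Complex.continuous_re
  have hf : AnalyticOnNhd ℂ (mellin (fun t : ℝ => csech (b * t) ^ (m + 1))) {w : ℂ | 0 < w.re} :=
    DifferentiableOn.analyticOnNhd (fun w hw => (mellin_differentiableAt_of_isBigO_rpow_exp hb
      (locallyIntegrableOn_csech_pow _ hb) (csech_pow_isBigO_exp m hb)
      (csech_pow_isBigO_rpow_zero _ hb) hw).differentiableWithinAt) hopen
  have hg : AnalyticOnNhd ℂ (fun s : ℂ => (2 : ℂ) ^ (2 * m + 1) / (m.factorial : ℂ) *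
      Complex.Gamma s * (4 * b) ^ (-s) * sechZeta m s) {w : ℂ | 0 < w.re} := by
    refine DifferentiableOn.analyticOnNhd (fun w hw => ?_) hopen
    have h1 : DifferentiableAt ℂ Complex.Gamma w :=
      Complex.differentiableAt_Gamma w fun k hk => by
        have hw' : 0 < w.re := hw
        rw [hk, Complex.neg_re, Complex.natCast_re] at hw'
        linarith [k.cast_nonneg (α := ℝ)]
    have h2 : DifferentiableAt ℂ (fun s : ℂ => (4 * b) ^ (-s)) w :=
      differentiableAt_id.neg.const_cpow (Or.inl hb4)
    exact (((h1.const_mul _).mul h2).mul (differentiable_sechZeta m w)).differentiableWithinAt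
  refine hf.eqOn_of_preconnected_of_eventuallyEq hg (convex_halfSpace_re_gt 0).isPreconnected
    (z₀ := (m : ℂ) + 2) ?_ ?_ hs
  · simp only [Set.mem_ofPred_eq, Complex.add_re, Complex.natCast_re, Complex.re_ofNat]
    positivity
  · filter_upwards [(isOpen_lt continuous_const Complex.continuous_re).mem_nhds
      (show (m : ℝ) + 1 < ((m : ℂ) + 2).re by simp)] with w hw
    exact mellin_csech_pow_of_lt_re m hb hw

/-! ### The integral of a power of the hyperbolic secant -/

theorem integrableOn_csech_pow (m : ℕ) {b : ℂ} (hb : 0 < b.re) :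
    MeasureTheory.IntegrableOn (fun t : ℝ => csech (b * t) ^ (m + 1)) (Set.Ioi 0) := by
  have h := mellinConvergent_of_isBigO_rpow_exp hb (locallyIntegrableOn_csech_pow _ hb)
    (csech_pow_isBigO_exp m hb) (csech_pow_isBigO_rpow_zero _ hb) (s := 1) (by simp)
  simpa [MellinConvergent] using h

theorem ofReal_inv_cosh_pow (n : ℕ) (t : ℝ) :
    (((Real.cosh t)⁻¹ ^ n : ℝ) : ℂ) = csech ((1 : ℂ) * t) ^ n := by
  simp [csech]

theorem integrableOn_inv_cosh_pow (m : ℕ) :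
    MeasureTheory.IntegrableOn (fun t : ℝ => (Real.cosh t)⁻¹ ^ (m + 1)) (Set.Ioi 0) := by
  have h := (integrableOn_csech_pow m (b := 1) (by simp)).re
  refine h.congr (Filter.Eventually.of_forall fun t => ?_)
  simp only [← ofReal_inv_cosh_pow]
  exact RCLike.ofReal_re (K := ℂ) _

theorem tendsto_inv_cosh_atTop : Filter.Tendsto (fun t : ℝ => (Real.cosh t)⁻¹) Filter.atTop (𝓝 0) := by
  refine Filter.Tendsto.inv_tendsto_atTop (Filter.tendsto_atTop_mono (fun t => ?_)
    (Real.tendsto_exp_atTop.atTop_div_const two_pos))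
  rw [Real.cosh_eq]
  linarith [Real.exp_pos (-t)]

theorem tendsto_tanh_atTop :
    Filter.Tendsto (fun t : ℝ => Real.sinh t * (Real.cosh t)⁻¹) Filter.atTop (𝓝 1) := by
  -- `tanh t = 1 - e^{-t} / cosh t`
  have h : Filter.Tendsto (fun t : ℝ => 1 - Real.exp (-t) * (Real.cosh t)⁻¹) Filter.atTop
      (𝓝 (1 - 0 * 0)) :=
    ((Real.tendsto_exp_atBot.comp Filter.tendsto_neg_atTop_atBot).mul
      tendsto_inv_cosh_atTop).const_sub 1
  rw [mul_zero, sub_zero] at h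
  refine h.congr fun t => ?_
  rw [← Real.cosh_sub_sinh]
  have := (Real.cosh_pos t).ne'
  field_simp
  ring

theorem hasDerivAt_sinh_mul_inv_cosh_pow (n : ℕ) (t : ℝ) :
    HasDerivAt (fun t => Real.sinh t * (Real.cosh t)⁻¹ ^ (n + 1))
      ((n + 1) * (Real.cosh t)⁻¹ ^ (n + 2) - n * (Real.cosh t)⁻¹ ^ n) t := by
  have hc := (Real.cosh_pos t).ne'
  convert! (Real.hasDerivAt_sinh t).mul (((Real.hasDerivAt_cosh t).inv hc).pow (n + 1)) using 1
  have hsq := Real.sinh_sq t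
  simp only [Nat.add_sub_cancel, Pi.inv_apply, Pi.pow_apply]
  push_cast
  have e : Real.sinh t * ((n + 1 : ℝ) * (Real.cosh t)⁻¹ ^ n * (-Real.sinh t / Real.cosh t ^ 2)) =
      -(n + 1 : ℝ) * (Real.cosh t)⁻¹ ^ n * (Real.cosh t ^ 2 - 1) * (Real.cosh t)⁻¹ ^ 2 := by
    rw [← hsq]
    field_simp
  rw [e]
  have h1 : (Real.cosh t)⁻¹ * Real.cosh t = 1 := inv_mul_cancel₀ hc
  rw [pow_add, pow_succ]
  generalize (Real.cosh t)⁻¹ = c at *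
  generalize Real.cosh t = d at *
  linear_combination (c ^ n * ((n + 1) * (c * d + 1) - 1)) * h1

theorem integral_inv_cosh :
    ∫ t in Set.Ioi (0 : ℝ), (Real.cosh t)⁻¹ ^ 1 = Real.pi / 2 := by
  have h := MeasureTheory.integral_Ioi_of_hasDerivAt_of_tendsto (a := 0)
    (f := fun t => Real.arctan (Real.sinh t)) (f' := fun t => (Real.cosh t)⁻¹ ^ 1)
    (m := Real.pi / 2) ?_ (fun t _ => ?_) (integrableOn_inv_cosh_pow 0) ?_
  · simpa using h
  · exact (Real.continuous_arctan.comp Real.continuous_sinh).continuousWithinAt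
  · convert! (Real.hasDerivAt_arctan (Real.sinh t)).comp t (Real.hasDerivAt_sinh t) using 1
    have hc := (Real.cosh_pos t).ne'
    rw [add_comm, ← Real.cosh_sq]
    field_simp
  · refine (Real.tendsto_arctan_atTop.mono_right nhdsWithin_le_nhds).comp ?_
    refine Filter.tendsto_atTop_mono' _ ?_ Filter.tendsto_id
    filter_upwards [Filter.eventually_ge_atTop 0] with t ht
    exact Real.self_le_sinh_iff.2 ht

theorem integral_inv_cosh_sq :
    ∫ t in Set.Ioi (0 : ℝ), (Real.cosh t)⁻¹ ^ 2 = 1 := by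
  have h := MeasureTheory.integral_Ioi_of_hasDerivAt_of_tendsto (a := 0)
    (f := fun t => Real.sinh t * (Real.cosh t)⁻¹) (f' := fun t => (Real.cosh t)⁻¹ ^ 2)
    (m := 1) ?_ (fun t _ => ?_) (integrableOn_inv_cosh_pow 1) tendsto_tanh_atTop
  · simpa using h
  · have := (hasDerivAt_sinh_mul_inv_cosh_pow 0 0).continuousAt
    simpa using this.continuousWithinAt
  · simpa using hasDerivAt_sinh_mul_inv_cosh_pow 0 t

/-- Integration of the derivative of `sinh * sech^(m + 2)`, which vanishes at `0` and at `∞`. -/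
theorem integral_inv_cosh_pow_add_two (m : ℕ) :
    ((m : ℝ) + 2) * ∫ t in Set.Ioi (0 : ℝ), (Real.cosh t)⁻¹ ^ (m + 3) =
      ((m : ℝ) + 1) * ∫ t in Set.Ioi (0 : ℝ), (Real.cosh t)⁻¹ ^ (m + 1) := by
  have i1 := (integrableOn_inv_cosh_pow (m + 2)).const_mul ((m : ℝ) + 2)
  have i2 := (integrableOn_inv_cosh_pow m).const_mul ((m : ℝ) + 1)
  have hd : ∀ t : ℝ, HasDerivAt (fun t => Real.sinh t * (Real.cosh t)⁻¹ ^ (m + 2))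
      (((m : ℝ) + 2) * (Real.cosh t)⁻¹ ^ (m + 3) - ((m : ℝ) + 1) * (Real.cosh t)⁻¹ ^ (m + 1)) t := by
    intro t
    convert! hasDerivAt_sinh_mul_inv_cosh_pow (m + 1) t using 1
    push_cast
    ring
  have hlim : Filter.Tendsto (fun t : ℝ => Real.sinh t * (Real.cosh t)⁻¹ ^ (m + 2)) Filter.atTop
      (𝓝 0) := by
    have := tendsto_tanh_atTop.mul (tendsto_inv_cosh_atTop.pow (m + 1))
    rw [zero_pow m.succ_ne_zero, mul_zero] at this
    refine this.congr fun t => ?_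
    ring
  have h := MeasureTheory.integral_Ioi_of_hasDerivAt_of_tendsto (a := 0)
    (hd 0).continuousAt.continuousWithinAt (fun t _ => hd t) (i1.sub i2) hlim
  rw [MeasureTheory.integral_sub i1 i2, MeasureTheory.integral_const_mul,
    MeasureTheory.integral_const_mul] at h
  simp only [Real.sinh_zero, zero_mul, sub_zero] at h
  linarith

theorem integral_inv_cosh_pow (m : ℕ) :
    ∫ t in Set.Ioi (0 : ℝ), (Real.cosh t)⁻¹ ^ (m + 1) =
      2 ^ m / 2 * Real.Gamma (((m : ℝ) + 1) / 2) ^ 2 / (m.factorial : ℝ) := by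
  induction m using Nat.twoStepInduction with
  | zero =>
    rw [integral_inv_cosh]
    simp only [Nat.cast_zero, zero_add, Real.Gamma_one_half_eq, Real.sq_sqrt Real.pi_pos.le]
    simp
    ring
  | one =>
    rw [integral_inv_cosh_sq]
    norm_num
  | more m ih _ =>
    have h := integral_inv_cosh_pow_add_two m
    rw [ih] at h
    have hg : Real.Gamma ((((m + 2 : ℕ) : ℝ) + 1) / 2) =
        ((m : ℝ) + 1) / 2 * Real.Gamma (((m : ℝ) + 1) / 2) := by
      rw [← Real.Gamma_add_one (by positivity)]
      congr 1
      push_cast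
      ring
    have h2 : ((m : ℝ) + 2) ≠ 0 := by positivity
    refine mul_left_cancel₀ h2 (h.trans ?_)
    rw [hg, Nat.factorial_succ, Nat.factorial_succ]
    push_cast
    field_simp
    ring

/-! ### Evaluation at `s = 1` -/

/-- The two evaluations of `∫ sech^(m + 1)` for `b = 1` compared. As the Mellin transform at `s = 1`
depends on `b` only through the factor `(4 * b)⁻¹`, this gives its value for every complex `b`. -/
theorem two_pow_mul_sechZeta_one (m : ℕ) :
    (2 : ℂ) ^ (2 * m + 1) * (sechZeta m 1 / 4) =
      2 ^ m / 2 * Complex.Gamma (((m : ℂ) + 1) / 2) ^ 2 := by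
  have h := mellin_csech_pow m (b := 1) (s := 1) (by simp) (by simp)
  have e : mellin (fun t : ℝ => csech ((1 : ℂ) * t) ^ (m + 1)) 1 =
      ((∫ t in Set.Ioi (0 : ℝ), (Real.cosh t)⁻¹ ^ (m + 1) : ℝ) : ℂ) := by
    rw [← integral_complex_ofReal, mellin]
    simp only [sub_self, Complex.cpow_zero, one_smul, ofReal_inv_cosh_pow]
  have hg : ((Real.Gamma (((m : ℝ) + 1) / 2) : ℝ) : ℂ) = Complex.Gamma (((m : ℂ) + 1) / 2) := by
    rw [← Complex.Gamma_ofReal]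
    push_cast
    rfl
  rw [e, integral_inv_cosh_pow] at h
  push_cast at h
  rw [hg, Complex.Gamma_one, Complex.cpow_neg_one] at h
  have hf : (m.factorial : ℂ) ≠ 0 := Nat.cast_ne_zero.2 m.factorial_ne_zero
  field_simp at h ⊢
  linear_combination -h

theorem hasDerivAt_mellin_csech_pow_one (m : ℕ) {b : ℂ} (hb : 0 < b.re) :
    HasDerivAt (mellin (fun t : ℝ => csech (b * t) ^ (m + 1)))
      ((2 : ℂ) ^ (2 * m + 1) / (m.factorial : ℂ) * (4 * b)⁻¹ *
        (deriv (sechZeta m) 1 -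
          (Real.eulerMascheroniConstant + Real.log 4 + Complex.log b) * sechZeta m 1)) 1 := by
  have hb0 : b ≠ 0 := by
    rintro rfl
    simp at hb
  have hb4 : 4 * b ≠ 0 := mul_ne_zero (by norm_num) hb0
  have hlog : Complex.log (4 * b) = Real.log 4 + Complex.log b := by
    have := Complex.log_ofReal_mul (r := 4) (by norm_num) hb0
    push_cast at this ⊢
    exact this
  have h1 := (Complex.hasDerivAt_Gamma_one.const_mul
    ((2 : ℂ) ^ (2 * m + 1) / (m.factorial : ℂ))).mul
      (((hasDerivAt_id (1 : ℂ)).neg).const_cpow (c := 4 * b) (Or.inl hb4))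
  have h2 := h1.mul (differentiable_sechZeta m 1).hasDerivAt
  refine (h2.congr_deriv ?_).congr_of_eventuallyEq ?_
  · simp only [Pi.neg_apply, Pi.mul_apply, id, Complex.Gamma_one, Complex.cpow_neg_one, hlog]
    ring
  · filter_upwards [(isOpen_lt continuous_const Complex.continuous_re).mem_nhds
      (show 0 < (1 : ℂ).re by simp)] with w hw
    exact mellin_csech_pow m hb hw

/-- The sum in the closed form of the log-sech integral, for `n = m + 1`. The shift `k ↦ k - 2` of the
summation index accounts for the factor `(-1 / 2) ^ 2 = 1 / 4`. -/
theorem sum_Icc_eq_sechZeta (m : ℕ) :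
    ∑ k ∈ Finset.Icc 2 (m + 1 + 1),
      (-1 / 2 : ℂ) ^ k * signedStirlingP (k - 2) (m + 1 - 1) (((m + 1 : ℕ) : ℂ) / 2) *
        (deriv (hurwitzZetaDiff (((m + 1 : ℕ) : ℝ) / 4) ((((m + 1 : ℕ) : ℝ) + 2) / 4))
            ((k : ℂ) - ((m + 1 : ℕ) : ℂ)) -
          ((Real.eulerMascheroniConstant : ℂ) + (Real.log 4 : ℂ)) *
            hurwitzZetaDiff (((m + 1 : ℕ) : ℝ) / 4) ((((m + 1 : ℕ) : ℝ) + 2) / 4)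
              ((k : ℂ) - ((m + 1 : ℕ) : ℂ))) =
      (deriv (sechZeta m) 1 -
        (Real.eulerMascheroniConstant + Real.log 4) * sechZeta m 1) / 4 := by
  have hd : deriv (sechZeta m) 1 = ∑ k ∈ Finset.range (m + 1),
      (-1 / 2 : ℂ) ^ k * signedStirlingP k m (((m : ℂ) + 1) / 2) *
        deriv (hurwitzZetaDiff (((m : ℝ) + 1) / 4) (((m : ℝ) + 1 + 2) / 4)) (1 + k - m) := by
    refine HasDerivAt.deriv (HasDerivAt.fun_sum fun k _ => HasDerivAt.const_mul _ ?_)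
    have h1 : HasDerivAt (fun s : ℂ => s + k - m) 1 1 :=
      ((hasDerivAt_id _).add_const _).sub_const _
    have h2 := (differentiable_hurwitzZetaDiff (((m : ℝ) + 1) / 4) (((m : ℝ) + 1 + 2) / 4)
      (1 + k - m)).hasDerivAt.comp 1 h1
    rw [mul_one] at h2
    exact h2
  rw [hd, sechZeta, Finset.mul_sum, ← Finset.sum_sub_distrib, Finset.sum_div,
    ← Finset.Ico_add_one_right_eq_Icc, Finset.sum_Ico_eq_sum_range]
  refine Finset.sum_congr (by congr 1) fun k _ => ?_
  rw [Nat.add_sub_cancel_left, Nat.add_sub_cancel]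
  push_cast
  rw [show (2 + (k : ℂ) - (m + 1)) = 1 + k - m by ring]
  ring

theorem theorem3p2 (n : ℕ) (hn : 1 ≤ n) (a : ℝ) (ha : 0 < a) (b : ℂ) (hb : 0 < b.re) :
    MeasureTheory.IntegrableOn
      (fun x : ℝ => (Real.log (a * x) : ℂ) * csech (b * (x : ℂ)) ^ n) (Set.Ioi 0) ∧
    ∫ x in Set.Ioi (0 : ℝ), (Real.log (a * x) : ℂ) * csech (b * (x : ℂ)) ^ n =
      (2 : ℂ) ^ ((n : ℤ) - 2) * Complex.Gamma ((n : ℂ) / 2) ^ 2 * Complex.log ((a : ℂ) / b) /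
          (b * ((n - 1).factorial : ℂ)) +
        (2 : ℂ) ^ (2 * n - 1) / (b * ((n - 1).factorial : ℂ)) *
          ∑ k ∈ Finset.Icc 2 (n + 1),
            (-1 / 2 : ℂ) ^ k * signedStirlingP (k - 2) (n - 1) ((n : ℂ) / 2) *
              (deriv (hurwitzZetaDiff ((n : ℝ) / 4) (((n : ℝ) + 2) / 4)) ((k : ℂ) - (n : ℂ)) -
                ((Real.eulerMascheroniConstant : ℂ) + (Real.log 4 : ℂ)) *
                  hurwitzZetaDiff ((n : ℝ) / 4) (((n : ℝ) + 2) / 4) ((k : ℂ) - (n : ℂ))) := by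
  obtain ⟨m, rfl⟩ : ∃ m, n = m + 1 := ⟨n - 1, by omega⟩
  rw [sum_Icc_eq_sechZeta]
  have hb0 : b ≠ 0 := by
    rintro rfl
    simp at hb
  obtain ⟨hconv, hder⟩ := mellin_hasDerivAt_of_isBigO_rpow (a := 2) (b := 0) (s := 1)
    (locallyIntegrableOn_csech_pow (m + 1) hb)
    ((csech_pow_isBigO_exp m hb).trans (isLittleO_exp_neg_mul_rpow_atTop hb _).isBigO)
    (by norm_num) (csech_pow_isBigO_rpow_zero (m + 1) hb) (by norm_num)
  -- The integrand with the extra factor `log x` is the `s`-derivative of the Mellin integrand.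
  have hval := hder.unique (hasDerivAt_mellin_csech_pow_one m hb)
  have hM := mellin_csech_pow m hb (s := 1) (by norm_num)
  simp only [MellinConvergent, mellin, sub_self, Complex.cpow_zero, one_smul,
    Complex.real_smul] at hconv hval hM
  have hI := integrableOn_csech_pow m hb
  have e : Set.EqOn (fun x : ℝ => (Real.log (a * x) : ℂ) * csech (b * (x : ℂ)) ^ (m + 1))
      (fun x : ℝ => (Real.log a : ℂ) * csech (b * (x : ℂ)) ^ (m + 1) +
        (Real.log x : ℂ) * csech (b * (x : ℂ)) ^ (m + 1)) (Set.Ioi 0) := by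
    intro x hx
    have hx' : x ≠ 0 := ne_of_gt hx
    simp only [Real.log_mul ha.ne' hx']
    push_cast
    ring
  refine ⟨(MeasureTheory.integrableOn_congr_fun e measurableSet_Ioi).2
    ((hI.const_mul _).add hconv), ?_⟩
  rw [MeasureTheory.setIntegral_congr_fun measurableSet_Ioi e,
    MeasureTheory.integral_add (hI.const_mul _) hconv, MeasureTheory.integral_const_mul,
    hval, hM]
  have hlog : Complex.log ((a : ℂ) / b) = Real.log a - Complex.log b := by
    rw [div_eq_mul_inv, Complex.log_ofReal_mul ha (inv_ne_zero hb0), Complex.log_inv,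
      sub_eq_add_neg]
    intro harg
    have := (Complex.arg_eq_pi_iff.1 harg).1
    linarith
  have hz : (2 : ℂ) ^ (((m + 1 : ℕ) : ℤ) - 2) = 2 ^ m / 2 := by
    rw [show (((m + 1 : ℕ) : ℤ) - 2) = (m : ℤ) - 1 by push_cast; ring,
      zpow_sub₀ two_ne_zero, zpow_natCast, zpow_one]
  have hpow : 2 * (m + 1) - 1 = 2 * m + 1 := by omega
  have hs := two_pow_mul_sechZeta_one m
  have hf : (m.factorial : ℂ) ≠ 0 := Nat.cast_ne_zero.2 m.factorial_ne_zero
  rw [hlog, hz, hpow, Nat.add_sub_cancel, Complex.Gamma_one, Complex.cpow_neg_one]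
  push_cast
  rw [← hs]
  field_simp
  ring
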